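/- For a finite connected graph $G$ and vertices $u,v$ of $G$, let $R_G[u,v]$ be the resistance distance: the effective resistance between $u$ and $v$ in the electrical network obtained from $G$ by replacing each edge with a unit resistor. Let $D_r(G)=\max_{u,v\in V(G)}R_G[u,v]$ be the resistance diameter of $G$. For $n\ge 1$ let $G_n=P_n\square C_4$ be the Cartesian product of the path $P_n$ on $n$ vertices and the cycle $C_4$ on $4$ vertices. Then the following limit exists and $$\lim_{n\to\infty}\bigl(D_r(G_{n+1})-D_r(G_n)\bigr)=\frac14.$$ -/

import Mathlib

open Filter Topology

namespace SimpleGraph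

section Resistance

variable {V : Type*} [Fintype V]

open Classical in
/-- `G` is viewed as an electrical network in which every edge is a unit resistor. The function `f`
is a vertex potential that arises when a unit current enters the network at `u` and leaves it at
`v`: by Ohm's law the current along an edge from `x` to `y` is `(f x - f y) / 1`, and by
Kirchhoff's current law the net current out of `x` along the edges equals the external current fed
in at `x`, which is `1` at `u`, `-1` at `v` and `0` elsewhere (and `0` everywhere if `u = v`). -/
def IsUnitCurrentPotential (G : SimpleGraph V) (u v : V) (f : V → ℝ) : Prop :=
  ∀ x : V, (∑ y : V, if G.Adj x y then f x - f y else 0)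
    = (if x = u then 1 else 0) - (if x = v then 1 else 0)

open Classical in
/-- The resistance distance `R_G[u, v]`: the potential difference between `u` and `v` when a unit
current enters the network at `u` and leaves it at `v`. For a connected graph such a potential
exists (`IsUnitCurrentPotential.exists_of_connected`) and the difference does not depend on its
choice (`resistanceDist_eq`). If no such potential exists the value is `0`. -/
noncomputable def resistanceDist (G : SimpleGraph V) (u v : V) : ℝ :=
  if h : ∃ f : V → ℝ, G.IsUnitCurrentPotential u v f then h.choose u - h.choose v else 0

/-- The resistance diameter `D_r(G)`: the maximum of the resistance distances over all pairs of
vertices (`isGreatest_resistanceDiam`). -/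
noncomputable def resistanceDiam (G : SimpleGraph V) : ℝ :=
  ⨆ p : V × V, G.resistanceDist p.1 p.2

open Classical in
theorem isUnitCurrentPotential_iff_lapMatrix (G : SimpleGraph V) (u v : V) (f : V → ℝ) :
    G.IsUnitCurrentPotential u v f ↔
      (G.lapMatrix ℝ).mulVec f = fun x => (if x = u then 1 else 0) - (if x = v then 1 else 0) := by
  rw [funext_iff]
  refine forall_congr' fun x => ?_
  rw [lapMatrix_mulVec_apply, ← Finset.sum_filter, ← neighborFinset_eq_filter,
    Finset.sum_sub_distrib]
  simp

theorem IsUnitCurrentPotential.exists_of_connected {G : SimpleGraph V} (hG : G.Connected)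
    (u v : V) : ∃ f : V → ℝ, G.IsUnitCurrentPotential u v f := by
  classical
  simp only [isUnitCurrentPotential_iff_lapMatrix]
  by_contra hne
  set b : V → ℝ := fun x => (if x = u then 1 else 0) - (if x = v then 1 else 0) with hb
  have hmem : b ∉ LinearMap.range (G.lapMatrix ℝ).mulVecLin := by
    rintro ⟨f, hf⟩
    exact hne ⟨f, hf⟩
  obtain ⟨φ, hφb, hφ⟩ := Submodule.exists_le_ker_of_notMem hmem
  set c : V → ℝ := fun x => φ (Pi.single x 1) with hc
  have hφc : ∀ g : V → ℝ, φ g = c ⬝ᵥ g := by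
    intro g
    rw [LinearMap.pi_apply_eq_sum_univ φ g]
    simp only [dotProduct, hc, smul_eq_mul]
    refine Finset.sum_congr rfl fun x _ => ?_
    rw [mul_comm]
    congr 2
    ext y
    simp [Pi.single_apply, eq_comm]
  have hLc : (G.lapMatrix ℝ).mulVec c = 0 := by
    have h1 : Matrix.vecMul c (G.lapMatrix ℝ) = 0 := by
      refine dotProduct_eq_zero _ fun g => ?_
      rw [← Matrix.dotProduct_mulVec, ← hφc]
      exact hφ ⟨g, rfl⟩
    rw [← Matrix.vecMul_transpose, (G.isSymm_lapMatrix (R := ℝ)).eq]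
    exact h1
  have hcc := (lapMatrix_mulVec_eq_zero_iff_forall_reachable G).1 hLc u v (hG.preconnected u v)
  apply hφb
  rw [hφc]
  simp [hb, dotProduct, mul_sub, Finset.sum_sub_distrib, hcc]

theorem resistanceDist_eq {G : SimpleGraph V} (hG : G.Connected) {u v : V} {f : V → ℝ}
    (hf : G.IsUnitCurrentPotential u v f) : G.resistanceDist u v = f u - f v := by
  classical
  have h : ∃ f : V → ℝ, G.IsUnitCurrentPotential u v f := ⟨f, hf⟩
  rw [resistanceDist, dif_pos h]
  have h1 := (isUnitCurrentPotential_iff_lapMatrix G u v _).1 h.choose_spec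
  have h2 := (isUnitCurrentPotential_iff_lapMatrix G u v _).1 hf
  have h3 : (G.lapMatrix ℝ).mulVec (h.choose - f) = 0 := by
    rw [Matrix.mulVec_sub, h1, h2, sub_self]
  have h4 := (lapMatrix_mulVec_eq_zero_iff_forall_reachable G).1 h3 u v (hG.preconnected u v)
  simp only [Pi.sub_apply] at h4
  linarith

theorem isGreatest_resistanceDiam [Nonempty V] (G : SimpleGraph V) :
    IsGreatest (Set.range fun p : V × V => G.resistanceDist p.1 p.2) G.resistanceDiam := by
  refine ⟨?_, ?_⟩
  · exact exists_eq_ciSup_of_finite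
  · rintro _ ⟨p, rfl⟩
    exact le_ciSup (f := fun p : V × V => G.resistanceDist p.1 p.2) (Set.finite_range _).bddAbove p

end Resistance

/-- The `n`-th block tower graph `G_n = P_n □ C_4`. -/
def blockTower (n : ℕ) : SimpleGraph (Fin n × Fin 4) :=
  pathGraph n □ cycleGraph 4

end SimpleGraph

/-! The Laplacian of `P_n □ C_4` is the sum of those of the factors, so it splits along the
eigenspaces of `C_4`, with eigenvalues 0, 2 and 4. On the eigenspace of `t > 0` the potential of a
unit source is the Green function of `L + t` on the path. On the constants it is `-|k - i| / 2`,
whose outflow at the ends does not depend on the source and cancels in differences. Hence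
`resistanceDist_blockTower`: the resistance is `|i - j| / 4`, plus diagonal Green terms, minus cross
terms.

The diagonal terms are largest at the ends (`pathGreen_self_le`), and the cross terms are `O(1 / (|i
- j| + 1))` (`abs_cross_le`). So the diameter is `(n - 1) / 4 + endResistance n + o(1)`. The
increments of `endResistance` vanish (`tendsto_pathGreen_zero_sub`), which leaves `1 / 4`. -/

namespace SimpleGraph

/-! ### Discrete hyperbolic functions -/

/-- The pair of sequences `(u, s)` with `u 0 = 1`, `s 0 = 0`, `s (k + 1) = s k + u k` and
`u (k + 1) = u k + t * s (k + 1)`. -/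
noncomputable def waveSeq (t : ℝ) : ℕ → ℝ × ℝ
  | 0 => (1, 0)
  | k + 1 => ((waveSeq t k).1 + t * ((waveSeq t k).2 + (waveSeq t k).1),
      (waveSeq t k).2 + (waveSeq t k).1)

/-- The solution of `u (k + 1) - 2 * u k + u (k - 1) = t * u k` with `u (-1) = u 0 = 1`. -/
noncomputable def waveU (t : ℝ) (k : ℕ) : ℝ := (waveSeq t k).1

/-- The partial sums of `waveU`. -/
noncomputable def waveS (t : ℝ) (k : ℕ) : ℝ := (waveSeq t k).2

@[simp] theorem waveU_zero (t : ℝ) : waveU t 0 = 1 := rfl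

@[simp] theorem waveS_zero (t : ℝ) : waveS t 0 = 0 := rfl

theorem waveS_succ (t : ℝ) (k : ℕ) : waveS t (k + 1) = waveS t k + waveU t k := rfl

theorem waveU_succ (t : ℝ) (k : ℕ) : waveU t (k + 1) = waveU t k + t * waveS t (k + 1) := rfl

/-- Analogue of the addition formulas for cosh and sinh. It evaluates the Wronskian in the Green
function and yields the product bounds below. -/
theorem wave_add (t : ℝ) (i m : ℕ) :
    waveU t (i + m) = waveU t i * waveU t m + t * (waveS t i * waveS t m) ∧
      waveS t (i + m + 1) = waveS t i * waveU t m + waveU t i * waveS t (m + 1) := by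
  induction m with
  | zero => simp [waveS_succ]
  | succ m ih =>
    obtain ⟨h1, h2⟩ := ih
    have h3 : waveU t (i + (m + 1)) =
        waveU t i * waveU t (m + 1) + t * (waveS t i * waveS t (m + 1)) := by
      rw [← add_assoc, waveU_succ t (i + m), h1, h2, waveU_succ t m, waveS_succ t m]
      ring
    refine ⟨h3, ?_⟩
    rw [waveS_succ t (i + (m + 1)), h3, ← add_assoc i m 1, h2, waveS_succ t (m + 1), waveU_succ t m]
    ring

section Positivity

variable {t : ℝ}

theorem wave_bounds (ht : 0 ≤ t) (k : ℕ) : 1 ≤ waveU t k ∧ (k : ℝ) ≤ waveS t k := by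
  induction k with
  | zero => simp
  | succ k ih =>
    have hs : ((k + 1 : ℕ) : ℝ) ≤ waveS t (k + 1) := by
      rw [waveS_succ]
      push_cast
      linarith [ih.1, ih.2]
    refine ⟨?_, hs⟩
    have h0 : (0 : ℝ) ≤ waveS t (k + 1) := le_trans (by positivity) hs
    rw [waveU_succ]
    nlinarith [ih.1, mul_nonneg ht h0]

theorem waveU_pos (ht : 0 ≤ t) (k : ℕ) : 0 < waveU t k :=
  lt_of_lt_of_le one_pos (wave_bounds ht k).1

theorem le_waveS (ht : 0 ≤ t) (k : ℕ) : (k : ℝ) ≤ waveS t k := (wave_bounds ht k).2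

theorem waveS_nonneg (ht : 0 ≤ t) (k : ℕ) : 0 ≤ waveS t k :=
  le_trans (by positivity) (le_waveS ht k)

theorem waveS_pos (ht : 0 ≤ t) {k : ℕ} (hk : 0 < k) : 0 < waveS t k :=
  lt_of_lt_of_le (by exact_mod_cast hk) (le_waveS ht k)

theorem waveU_mul_le (ht : 0 ≤ t) (i m : ℕ) : waveU t i * waveU t m ≤ waveU t (i + m) := by
  rw [(wave_add t i m).1]
  have := mul_nonneg ht (mul_nonneg (waveS_nonneg ht i) (waveS_nonneg ht m))
  linarith

theorem waveU_mul_waveS_le (ht : 0 ≤ t) (i m : ℕ) :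
    waveU t i * waveS t (m + 1) ≤ waveS t (i + m + 1) := by
  rw [(wave_add t i m).2]
  have := mul_nonneg (waveS_nonneg ht i) (waveU_pos ht m).le
  linarith

end Positivity

/-- Analogue of `cosh² - sinh² = 1`: the recurrence conserves this quadratic form. -/
theorem wave_det (t : ℝ) (k : ℕ) :
    waveU t k * waveU t (k + 1) - t * waveS t (k + 1) ^ 2 = 1 := by
  induction k with
  | zero => simp [waveU_succ, waveS_succ]
  | succ k ih =>
    rw [waveU_succ t (k + 1), waveS_succ t (k + 1)]
    rw [waveU_succ t k] at ih ⊢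
    linear_combination ih

/-! ### Green functions on the path -/

/-- The Green function of the operator `L + t`, where `L` is the Laplacian of the path with vertex
set `{0, …, n - 1}`. -/
noncomputable def pathGreen (t : ℝ) (n i k : ℕ) : ℝ :=
  waveU t (min i k) * waveU t (n - 1 - max i k) / (t * waveS t n)

theorem pathGreen_comm (t : ℝ) (n i k : ℕ) : pathGreen t n i k = pathGreen t n k i := by
  rw [pathGreen, pathGreen, min_comm, max_comm]

theorem pathGreen_of_le (t : ℝ) {n i k : ℕ} (h : i ≤ k) :
    pathGreen t n i k = waveU t i * waveU t (n - 1 - k) / (t * waveS t n) := by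
  rw [pathGreen, min_eq_left h, max_eq_right h]

/-- The Laplacian of the path with vertex set `{0, …, n - 1}`. -/
noncomputable def pathLap (n : ℕ) (g : ℕ → ℝ) (k : ℕ) : ℝ :=
  (if 0 < k then g k - g (k - 1) else 0) + (if k + 1 < n then g k - g (k + 1) else 0)

theorem pathLap_pathGreen {t : ℝ} (ht : 0 < t) {n i k : ℕ} (hi : i < n) (hk : k < n) :
    pathLap n (pathGreen t n i) k + t * pathGreen t n i k = if k = i then 1 else 0 := by
  have hS : t * waveS t n ≠ 0 := (mul_pos ht (waveS_pos ht.le (by omega))).ne'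
  -- Current through the edge to the left of `k`. The end `k = 0` is included because `waveS t 0 =
  -- 0`; `hright` is the mirror image.
  have hleft : ∀ k, k ≤ i → (if 0 < k then pathGreen t n i k - pathGreen t n i (k - 1) else 0) =
      t * waveS t k * waveU t (n - 1 - i) / (t * waveS t n) := by
    intro k hki
    rcases k with _ | k
    · simp
    · rw [if_pos (by omega), pathGreen_comm, pathGreen_of_le t hki, pathGreen_comm,
        pathGreen_of_le t (by omega : k + 1 - 1 ≤ i), Nat.add_sub_cancel, waveU_succ]
      ring
  have hright : ∀ k, i ≤ k → k < n →
      (if k + 1 < n then pathGreen t n i k - pathGreen t n i (k + 1) else 0) =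
        waveU t i * (t * waveS t (n - 1 - k)) / (t * waveS t n) := by
    intro k hik hkn
    split_ifs with h
    · obtain ⟨m, hm⟩ : ∃ m, n - 1 - k = m + 1 := ⟨n - 1 - k - 1, by omega⟩
      rw [pathGreen_of_le t hik, pathGreen_of_le t (by omega : i ≤ k + 1), hm,
        (by omega : n - 1 - (k + 1) = m), waveU_succ]
      ring
    · rw [(by omega : n - 1 - k = 0)]
      simp
  rw [pathLap]
  rcases lt_trichotomy k i with h | h | h
  · have h1 := hleft (k + 1) h
    rw [if_pos (by omega), Nat.add_sub_cancel] at h1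
    rw [hleft k h.le, if_pos (by omega), ← neg_sub, h1, pathGreen_comm, pathGreen_of_le t h.le,
      if_neg h.ne, waveS_succ]
    ring
  · subst h
    obtain ⟨m, rfl⟩ : ∃ m, n = k + m + 1 := ⟨n - 1 - k, by omega⟩
    have h2 := (wave_add t k m).2
    rw [hleft k le_rfl, hright k le_rfl hk, pathGreen_of_le t le_rfl, if_pos rfl,
      (by omega : k + m + 1 - 1 - k = m)]
    rw [← div_self hS, h2, waveS_succ]
    ring
  · obtain ⟨k, rfl⟩ : ∃ j, k = j + 1 := ⟨k - 1, by omega⟩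
    have h1 := hright k (by omega) (by omega)
    rw [if_pos hk] at h1
    rw [hright (k + 1) h.le hk, if_pos (by omega), Nat.add_sub_cancel, ← neg_sub, h1,
      pathGreen_of_le t h.le, if_neg h.ne', (by omega : n - 1 - k = n - 1 - (k + 1) + 1),
      waveS_succ]
    ring

/-- The slope is `±1/2` with a kink at `i`: a unit current enters at `i` and half of it leaves at
each end, wherever `i` is. -/
theorem pathLap_neg_abs {n i k : ℕ} (hi : i < n) (hk : k < n) :
    pathLap n (fun k => -|(k : ℝ) - i| / 2) k =
      (if k = i then 1 else 0) - ((if k = 0 then 1 else 0) + if k + 1 = n then 1 else 0) / 2 := by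
  have hstep : ∀ a : ℕ, |((a + 1 : ℕ) : ℝ) - i| = |(a : ℝ) - i| + if i ≤ a then 1 else -1 := by
    intro a
    push_cast
    split_ifs with h
    · have h' : (i : ℝ) ≤ a := by exact_mod_cast h
      rw [abs_of_nonneg (by linarith), abs_of_nonneg (by linarith)]
      ring
    · have h' : (a : ℝ) + 1 ≤ i := by exact_mod_cast (by omega : a + 1 ≤ i)
      rw [abs_of_nonpos (by linarith), abs_of_nonpos (by linarith)]
      ring
  rcases k with _ | k <;> simp only [pathLap, Nat.add_sub_cancel, hstep] <;> ring_nf <;>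
    split_ifs <;> first | omega | norm_num

theorem sum_pathGraph (n : ℕ) (g : ℕ → ℝ) (k : Fin n) [DecidableRel (pathGraph n).Adj] :
    (∑ l : Fin n, if (pathGraph n).Adj k l then g k - g l else 0) = pathLap n g k := by
  have h : ∀ l : Fin n, (if (pathGraph n).Adj k l then g k - g l else 0) =
      (if (l : ℕ) + 1 = k then g k - g l else 0) +
        (if (k : ℕ) + 1 = l then g k - g l else 0) := by
    intro l
    simp only [pathGraph_adj]
    split_ifs <;> first | omega | simp
  simp only [h, Finset.sum_add_distrib, pathLap]
  congr 1
  · rw [Fin.sum_univ_eq_sum_range (fun l => if l + 1 = (k : ℕ) then g k - g l else 0) n]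
    have hk := k.2
    rcases hk' : (k : ℕ) with _ | m
    · simp
    · simp only [Nat.add_right_cancel_iff]
      rw [Finset.sum_ite_eq', if_pos (Finset.mem_range.2 (by omega))]
      simp
  · rw [Fin.sum_univ_eq_sum_range (fun l => if (k : ℕ) + 1 = l then g k - g l else 0) n,
      Finset.sum_ite_eq]
    simp

/-! ### Spectral decomposition of `C_4` -/

/-- The spectral projection of the Laplacian of `C_4` for the eigenvalue `2`. -/
noncomputable def cycleProjTwo (a c : Fin 4) : ℝ :=
  if c = a then 1 / 2 else if c = a + 2 then -1 / 2 else 0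

/-- The spectral projection of the Laplacian of `C_4` for the eigenvalue `4`. -/
noncomputable def cycleProjFour (a c : Fin 4) : ℝ :=
  if c = a ∨ c = a + 2 then 1 / 4 else -1 / 4

theorem cycleGraph_four_adj (a c : Fin 4) : (cycleGraph 4).Adj a c ↔ c = a + 1 ∨ c = a + 3 := by
  revert a c
  simp only [cycleGraph_adj]
  decide

theorem sum_cycleGraph_four (g : Fin 4 → ℝ) (c : Fin 4) [DecidableRel (cycleGraph 4).Adj] :
    (∑ d : Fin 4, if (cycleGraph 4).Adj c d then g c - g d else 0) =
      2 * g c - g (c + 1) - g (c + 3) := by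
  simp only [cycleGraph_four_adj, Fin.sum_univ_four]
  fin_cases c <;> simp <;> ring

theorem cycleProjTwo_lap (a c : Fin 4) :
    2 * cycleProjTwo a c - cycleProjTwo a (c + 1) - cycleProjTwo a (c + 3) =
      2 * cycleProjTwo a c := by
  fin_cases a <;> fin_cases c <;> simp [cycleProjTwo, Fin.ext_iff] <;> norm_num

theorem cycleProjFour_lap (a c : Fin 4) :
    2 * cycleProjFour a c - cycleProjFour a (c + 1) - cycleProjFour a (c + 3) =
      4 * cycleProjFour a c := by
  fin_cases a <;> fin_cases c <;> simp [cycleProjFour, Fin.ext_iff] <;> norm_num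

/-- Resolution of the identity, with `1 / 4` the projection onto constants; it splits a point source
into the three modes. -/
theorem cycleProj_sum (a c : Fin 4) :
    1 / 4 + cycleProjTwo a c + cycleProjFour a c = if c = a then 1 else 0 := by
  fin_cases a <;> fin_cases c <;>
    simp [cycleProjTwo, cycleProjFour, Fin.ext_iff] <;> norm_num

theorem abs_cycleProjTwo_le (a c : Fin 4) : |cycleProjTwo a c| ≤ 1 / 2 := by
  rw [cycleProjTwo, abs_le]
  split_ifs <;> norm_num

theorem abs_cycleProjFour_le (a c : Fin 4) : |cycleProjFour a c| ≤ 1 / 4 := by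
  rw [cycleProjFour, abs_le]
  split_ifs <;> norm_num

theorem cycleProjTwo_comm (a c : Fin 4) : cycleProjTwo a c = cycleProjTwo c a := by
  fin_cases a <;> fin_cases c <;> simp [cycleProjTwo, Fin.ext_iff]

theorem cycleProjFour_comm (a c : Fin 4) : cycleProjFour a c = cycleProjFour c a := by
  fin_cases a <;> fin_cases c <;> simp [cycleProjFour, Fin.ext_iff]

/-! ### Potentials and resistances on the tower -/

open Classical in
theorem sum_blockTower (n : ℕ) (f : ℕ → Fin 4 → ℝ) (x : Fin n × Fin 4) :
    (∑ y : Fin n × Fin 4, if (blockTower n).Adj x y then f x.1 x.2 - f y.1 y.2 else 0) =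
      pathLap n (fun k => f k x.2) x.1 +
        (2 * f x.1 x.2 - f x.1 (x.2 + 1) - f x.1 (x.2 + 3)) := by
  have h : ∀ y : Fin n × Fin 4,
      (if (blockTower n).Adj x y then f x.1 x.2 - f y.1 y.2 else 0) =
        (if x.2 = y.2 then if (pathGraph n).Adj x.1 y.1 then f x.1 x.2 - f y.1 x.2 else 0 else 0) +
        (if x.1 = y.1 then if (cycleGraph 4).Adj x.2 y.2 then f x.1 x.2 - f x.1 y.2 else 0
          else 0) := by
    rintro ⟨k, c⟩
    obtain ⟨l, d⟩ := x
    simp only [blockTower, boxProd_adj]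
    by_cases h1 : d = c
    · subst h1
      by_cases h2 : l = k <;> simp [h2]
    · by_cases h2 : l = k
      · subst h2
        simp [h1]
      · simp [h1, h2]
  simp only [h, Finset.sum_add_distrib]
  congr 1
  · rw [Fintype.sum_prod_type, ← sum_pathGraph n (fun k => f k x.2) x.1]
    simp
  · rw [Fintype.sum_prod_type_right, ← sum_cycleGraph_four (f x.1) x.2]
    simp

/-- The potential on `P_n □ C_4` of a unit current that enters at the vertex `(i, a)` and leaves
evenly through the two end cycles. -/
noncomputable def towerPotential (n i : ℕ) (a : Fin 4) (k : ℕ) (c : Fin 4) : ℝ :=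
  1 / 4 * (-|(k : ℝ) - i| / 2) + cycleProjTwo a c * pathGreen 2 n i k +
    cycleProjFour a c * pathGreen 4 n i k

theorem pathLap_combination (n : ℕ) (g₁ g₂ g₃ : ℕ → ℝ) (a b c : ℝ) (k : ℕ) :
    pathLap n (fun k => a * g₁ k + b * g₂ k + c * g₃ k) k =
      a * pathLap n g₁ k + b * pathLap n g₂ k + c * pathLap n g₃ k := by
  simp only [pathLap]
  split_ifs <;> ring

theorem lap_towerPotential {n i k : ℕ} (hi : i < n) (hk : k < n) (a c : Fin 4) :
    pathLap n (fun k => towerPotential n i a k c) k +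
        (2 * towerPotential n i a k c - towerPotential n i a k (c + 1) -
          towerPotential n i a k (c + 3)) =
      (if k = i ∧ c = a then 1 else 0) -
        ((if k = 0 then 1 else 0) + if k + 1 = n then 1 else 0) / 8 := by
  have h2 := pathLap_pathGreen (t := 2) two_pos hi hk
  have h4 := pathLap_pathGreen (t := 4) four_pos hi hk
  have h0 := pathLap_neg_abs hi hk
  have hs := cycleProj_sum a c
  have e2 := cycleProjTwo_lap a c
  have e4 := cycleProjFour_lap a c
  have hδ : (if k = i ∧ c = a then (1 : ℝ) else 0) =
      (if k = i then 1 else 0) * (if c = a then 1 else 0) := by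
    split_ifs <;> simp_all
  simp only [towerPotential]
  rw [pathLap_combination n (fun k => -|(k : ℝ) - i| / 2), h0, hδ, ← hs]
  linear_combination cycleProjTwo a c * h2 + cycleProjFour a c * h4 +
    pathGreen 2 n i k * e2 + pathGreen 4 n i k * e4

theorem isUnitCurrentPotential_blockTower {n : ℕ} (u v : Fin n × Fin 4) :
    (blockTower n).IsUnitCurrentPotential u v fun x =>
      towerPotential n u.1 u.2 x.1 x.2 - towerPotential n v.1 v.2 x.1 x.2 := by
  classical
  intro x
  have h := sum_blockTower n (fun k c => towerPotential n u.1 u.2 k c -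
    towerPotential n v.1 v.2 k c) x
  have hu := lap_towerPotential u.1.2 x.1.2 u.2 x.2
  have hv := lap_towerPotential v.1.2 x.1.2 v.2 x.2
  have e : ∀ w : Fin n × Fin 4, ((x.1 : ℕ) = w.1 ∧ x.2 = w.2) ↔ x = w := fun w => by
    rw [Prod.ext_iff, ← Fin.ext_iff]
  simp only [e] at hu hv
  have hl : pathLap n (fun k => towerPotential n u.1 u.2 k x.2 -
      towerPotential n v.1 v.2 k x.2) x.1 =
      pathLap n (fun k => towerPotential n u.1 u.2 k x.2) x.1 -
        pathLap n (fun k => towerPotential n v.1 v.2 k x.2) x.1 := by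
    simp only [pathLap]
    split_ifs <;> ring
  rw [hl] at h
  refine Eq.trans ?_ (h.trans (by split_ifs at hu hv ⊢ <;> linear_combination hu - hv))
  refine Finset.sum_congr rfl fun y _ => ?_
  congr

theorem blockTower_connected {n : ℕ} (hn : 0 < n) : (blockTower n).Connected := by
  obtain ⟨m, rfl⟩ : ∃ m, n = m + 1 := ⟨n - 1, by omega⟩
  exact (pathGraph_connected m).boxProd cycleGraph_connected

theorem resistanceDist_blockTower {n : ℕ} (u v : Fin n × Fin 4) :
    (blockTower n).resistanceDist u v = |(u.1 : ℝ) - (v.1 : ℝ)| / 4 +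
      (pathGreen 2 n u.1 u.1 + pathGreen 2 n v.1 v.1) / 2 +
      (pathGreen 4 n u.1 u.1 + pathGreen 4 n v.1 v.1) / 4 -
      2 * cycleProjTwo u.2 v.2 * pathGreen 2 n u.1 v.1 -
      2 * cycleProjFour u.2 v.2 * pathGreen 4 n u.1 v.1 := by
  have hn : 0 < n := lt_of_le_of_lt (Nat.zero_le _) u.1.2
  rw [resistanceDist_eq (blockTower_connected hn) (isUnitCurrentPotential_blockTower u v)]
  have h2 : ∀ a, cycleProjTwo a a = 1 / 2 := fun a => by simp [cycleProjTwo]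
  have h4 : ∀ a, cycleProjFour a a = 1 / 4 := fun a => by simp [cycleProjFour]
  simp only [towerPotential, h2, h4, pathGreen_comm _ n v.1 u.1, cycleProjTwo_comm v.2 u.2,
    cycleProjFour_comm v.2 u.2, sub_self, abs_zero, abs_sub_comm (v.1 : ℝ) (u.1 : ℝ)]
  ring

/-! ### Size and decay of the Green function -/

theorem pathGreen_nonneg {t : ℝ} (ht : 0 < t) (n i k : ℕ) : 0 ≤ pathGreen t n i k :=
  div_nonneg (mul_pos (waveU_pos ht.le _) (waveU_pos ht.le _)).le
    (mul_nonneg ht.le (waveS_nonneg ht.le n))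

theorem pathGreen_self_le {t : ℝ} (ht : 0 < t) {n i : ℕ} (hi : i < n) :
    pathGreen t n i i ≤ pathGreen t n 0 0 := by
  rw [pathGreen_of_le t le_rfl, pathGreen_of_le t le_rfl]
  refine div_le_div_of_nonneg_right ?_ (mul_nonneg ht.le (waveS_nonneg ht.le n))
  have h := waveU_mul_le ht.le i (n - 1 - i)
  rw [(by omega : i + (n - 1 - i) = n - 1)] at h
  simpa using h

theorem pathGreen_last_last (t : ℝ) {n : ℕ} :
    pathGreen t n (n - 1) (n - 1) = pathGreen t n 0 0 := by
  simp [pathGreen_of_le]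

/-- With `k = i + d` and `n = i + m + d + 1`, the addition formulas give `u_i u_m s_{d+1} ≤ s_n`,
and `s_{d+1} ≥ d + 1`. This decay is crude but enough. -/
theorem pathGreen_le_of_le {t : ℝ} (ht : 0 < t) {n i k : ℕ} (hik : i ≤ k) (hk : k < n) :
    pathGreen t n i k ≤ 1 / (t * (|(i : ℝ) - k| + 1)) := by
  obtain ⟨d, rfl⟩ := Nat.exists_eq_add_of_le hik
  have hd : |(i : ℝ) - (i + d : ℕ)| = d := by
    push_cast
    rw [sub_add_cancel_left, abs_neg, Nat.abs_cast]
  obtain ⟨m, rfl⟩ : ∃ m, n = i + m + d + 1 := ⟨n - 1 - d - i, by omega⟩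
  rw [pathGreen_of_le t hik, (by omega : i + m + d + 1 - 1 - (i + d) = m), hd,
    div_le_div_iff₀ (mul_pos ht (waveS_pos ht.le (by omega))) (by positivity)]
  have h1 := waveU_mul_le ht.le i m
  have h2 := waveU_mul_waveS_le ht.le (i + m) d
  have h3 := le_waveS ht.le (d + 1)
  push_cast at h3
  have h4 : waveU t i * waveU t m * (d + 1) ≤ waveS t (i + m + d + 1) :=
    le_trans (mul_le_mul h1 h3 (by positivity) (waveU_pos ht.le _).le) h2
  nlinarith [mul_le_mul_of_nonneg_left h4 ht.le]

theorem pathGreen_le {t : ℝ} (ht : 0 < t) {n i k : ℕ} (hi : i < n) (hk : k < n) :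
    pathGreen t n i k ≤ 1 / (t * (|(i : ℝ) - k| + 1)) := by
  rcases le_total i k with h | h
  · exact pathGreen_le_of_le ht h hk
  · rw [pathGreen_comm, abs_sub_comm]
    exact pathGreen_le_of_le ht h hi

/-! ### Two-sided bounds for the resistance diameter -/

/-- The contribution of the nonconstant modes of `C_4` to the resistance between the two ends of
the block tower, up to a vanishing error. -/
noncomputable def endResistance (n : ℕ) : ℝ := pathGreen 2 n 0 0 + pathGreen 4 n 0 0 / 2

theorem abs_cross_le {n : ℕ} (u v : Fin n × Fin 4) :
    |2 * cycleProjTwo u.2 v.2 * pathGreen 2 n u.1 v.1 +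
      2 * cycleProjFour u.2 v.2 * pathGreen 4 n u.1 v.1| ≤
        5 / (8 * (|(u.1 : ℝ) - (v.1 : ℝ)| + 1)) := by
  have h2 := pathGreen_le (t := 2) two_pos u.1.2 v.1.2
  have h4 := pathGreen_le (t := 4) four_pos u.1.2 v.1.2
  have p2 := pathGreen_nonneg (t := 2) two_pos n u.1 v.1
  have p4 := pathGreen_nonneg (t := 4) four_pos n u.1 v.1
  have c2 := abs_cycleProjTwo_le u.2 v.2
  have c4 := abs_cycleProjFour_le u.2 v.2
  have hd : 0 < |(u.1 : ℝ) - (v.1 : ℝ)| + 1 := by positivity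
  -- The constant is `5/8 = 2 · (1/2) · (1/2) + 2 · (1/4) · (1/4)`.
  have e : 5 / (8 * (|(u.1 : ℝ) - (v.1 : ℝ)| + 1)) = 1 / (2 * (|(u.1 : ℝ) - (v.1 : ℝ)| + 1)) +
      1 / (4 * (|(u.1 : ℝ) - (v.1 : ℝ)| + 1)) / 2 := by
    field_simp
    norm_num
  refine (abs_add_le _ _).trans ?_
  rw [abs_mul, abs_mul, abs_mul, abs_mul, abs_of_nonneg p2, abs_of_nonneg p4, abs_two, e]
  have m2 := mul_le_mul_of_nonneg_right c2 p2
  have m4 := mul_le_mul_of_nonneg_right c4 p4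
  linarith

theorem resistanceDiam_blockTower_le {n : ℕ} (hn : 4 ≤ n) :
    (blockTower n).resistanceDiam ≤ ((n : ℝ) - 1) / 4 + endResistance n + 5 / (8 * (n - 2)) := by
  have : Nonempty (Fin n × Fin 4) := ⟨(⟨0, by omega⟩, 0)⟩
  obtain ⟨⟨u, v⟩, h⟩ := (isGreatest_resistanceDiam (blockTower n)).1
  rw [← h]
  dsimp only
  rw [resistanceDist_blockTower]
  have hc := (abs_le.1 (abs_cross_le u v)).1
  have hu2 := pathGreen_self_le (t := 2) two_pos u.1.2
  have hv2 := pathGreen_self_le (t := 2) two_pos v.1.2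
  have hu4 := pathGreen_self_le (t := 4) four_pos u.1.2
  have hv4 := pathGreen_self_le (t := 4) four_pos v.1.2
  have hn' : (4 : ℝ) ≤ n := by exact_mod_cast hn
  obtain ⟨d, hd, hdn⟩ : ∃ d : ℕ, |(u.1 : ℝ) - (v.1 : ℝ)| = d ∧ d + 1 ≤ n := by
    have h1 := u.1.2
    have h2 := v.1.2
    rcases le_total (u.1 : ℕ) v.1 with h | h
    · refine ⟨v.1 - u.1, ?_, by omega⟩
      rw [abs_sub_comm, Nat.cast_sub h, abs_of_nonneg (sub_nonneg.2 (by exact_mod_cast h))]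
    · refine ⟨u.1 - v.1, ?_, by omega⟩
      rw [Nat.cast_sub h, abs_of_nonneg (sub_nonneg.2 (by exact_mod_cast h))]
  rw [hd] at hc ⊢
  -- If `d ≤ n - 4`, the linear term loses at least `3/4`, more than the cross term's `5/8`;
  -- otherwise `d + 1 ≥ n - 2`.
  have key : (d : ℝ) / 4 + 5 / (8 * (d + 1)) ≤ ((n : ℝ) - 1) / 4 + 5 / (8 * (n - 2)) := by
    have hdn' : (d : ℝ) + 1 ≤ n := by exact_mod_cast hdn
    rcases le_or_gt (d + 4) n with h | h
    · have h' : (d : ℝ) + 4 ≤ n := by exact_mod_cast h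
      have h1 : 5 / (8 * ((d : ℝ) + 1)) ≤ 5 / 8 :=
        div_le_div_of_nonneg_left (by norm_num) (by norm_num)
          (by linarith [(Nat.cast_nonneg d : (0 : ℝ) ≤ d)])
      have h2 : 0 ≤ 5 / (8 * ((n : ℝ) - 2)) := div_nonneg (by norm_num) (by linarith)
      linarith
    · have h' : (n : ℝ) ≤ d + 3 := by exact_mod_cast (by omega : n ≤ d + 3)
      have h1 : 5 / (8 * ((d : ℝ) + 1)) ≤ 5 / (8 * ((n : ℝ) - 2)) :=
        div_le_div_of_nonneg_left (by norm_num) (by linarith) (by linarith)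
      linarith
  rw [endResistance]
  linarith

theorem le_resistanceDiam_blockTower {n : ℕ} (hn : 0 < n) :
    ((n : ℝ) - 1) / 4 + endResistance n - 5 / (8 * n) ≤ (blockTower n).resistanceDiam := by
  have : Nonempty (Fin n × Fin 4) := ⟨(⟨0, hn⟩, 0)⟩
  -- Any vertices of the two end cycles would do, since the cross terms are bounded in absolute
  -- value.
  let u : Fin n × Fin 4 := (⟨0, hn⟩, 0)
  let v : Fin n × Fin 4 := (⟨n - 1, by omega⟩, 0)
  refine le_trans ?_ ((isGreatest_resistanceDiam (blockTower n)).2 ⟨(u, v), rfl⟩)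
  dsimp only
  rw [resistanceDist_blockTower]
  have hc := (abs_le.1 (abs_cross_le u v)).2
  have h0 : ((u.1 : ℕ)) = 0 := rfl
  have h1 : ((v.1 : ℕ)) = n - 1 := rfl
  have hn' : (1 : ℝ) ≤ n := by exact_mod_cast hn
  have hd : |(u.1 : ℝ) - (v.1 : ℝ)| = n - 1 := by
    rw [h0, h1, Nat.cast_sub hn, abs_sub_comm, abs_of_nonneg] <;> push_cast <;> linarith
  rw [hd, sub_add_cancel] at hc
  rw [hd, endResistance]
  rw [h0, h1] at hc ⊢
  rw [pathGreen_last_last, pathGreen_last_last]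
  linarith

/-! ### Passage to the limit -/

theorem tendsto_pathGreen_zero_sub {t : ℝ} (ht : 0 < t) :
    Tendsto (fun n : ℕ => pathGreen t (n + 1) 0 0 - pathGreen t n 0 0) atTop (𝓝 0) := by
  -- The shift avoids `n = 0`, where `n - 1` truncates and the denominator `t * waveS t n` is zero.
  rw [← tendsto_add_atTop_iff_nat 1]
  have h : ∀ n : ℕ, ‖pathGreen t (n + 1 + 1) 0 0 - pathGreen t (n + 1) 0 0‖ ≤
      1 / t * (1 / ((n : ℝ) + 1)) := by
    intro n
    have h1 := waveS_pos ht.le (Nat.succ_pos n)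
    have h2 := waveS_pos ht.le (Nat.succ_pos (n + 1))
    have hd := wave_det t n
    have b1 := le_waveS ht.le (n + 1)
    have b2 := le_waveS ht.le (n + 1 + 1)
    -- Over the common denominator the numerator is `t s_{n+1}² - u_n u_{n+1}`, which is `-1` by
    -- `wave_det`.
    have e : pathGreen t (n + 1 + 1) 0 0 - pathGreen t (n + 1) 0 0 =
        -(1 / t * (1 / (waveS t (n + 1) * waveS t (n + 1 + 1)))) := by
      simp only [pathGreen_of_le t le_rfl, waveU_zero, Nat.add_sub_cancel, Nat.sub_zero, one_mul]
      have hs := waveS_succ t (n + 1)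
      have hu := waveU_succ t n
      field_simp
      linear_combination -waveU t n * hs + waveS t (n + 1) * hu - hd
    rw [e, norm_neg, Real.norm_of_nonneg (by positivity)]
    refine mul_le_mul_of_nonneg_left ?_ (by positivity)
    refine one_div_le_one_div_of_le (by positivity) ?_
    push_cast at b1 b2
    nlinarith [(Nat.cast_nonneg n : (0 : ℝ) ≤ n)]
  refine squeeze_zero_norm h ?_
  simpa using tendsto_one_div_add_atTop_nhds_zero_nat.const_mul (1 / t)

theorem tendsto_resistanceDiam_sub :
    Tendsto (fun n : ℕ => (blockTower n).resistanceDiam - (((n : ℝ) - 1) / 4 + endResistance n))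
      atTop (𝓝 0) := by
  have hcast := tendsto_natCast_atTop_atTop (R := ℝ)
  have hlow : Tendsto (fun n : ℕ => -(5 / (8 * (n : ℝ)))) atTop (𝓝 0) := by
    simpa using (tendsto_const_nhds.div_atTop (hcast.const_mul_atTop (by norm_num : (0 : ℝ) < 8))
      : Tendsto (fun n : ℕ => (5 : ℝ) / (8 * (n : ℝ))) atTop (𝓝 0)).neg
  have hup : Tendsto (fun n : ℕ => 5 / (8 * ((n : ℝ) - 2))) atTop (𝓝 0) :=
    tendsto_const_nhds.div_atTop
      ((tendsto_atTop_add_const_right atTop (-2 : ℝ) hcast).const_mul_atTop (by norm_num))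
  refine tendsto_of_tendsto_of_tendsto_of_le_of_le' hlow hup ?_ ?_
  · filter_upwards [eventually_ge_atTop 4] with n hn
    linarith [le_resistanceDiam_blockTower (by omega : 0 < n)]
  · filter_upwards [eventually_ge_atTop 4] with n hn
    linarith [resistanceDiam_blockTower_le hn]

end SimpleGraph

theorem mainTheorem4 :
    Tendsto (fun n : ℕ => (SimpleGraph.blockTower (n + 1)).resistanceDiam
        - (SimpleGraph.blockTower n).resistanceDiam)
      atTop (𝓝 (1 / 4 : ℝ)) := by
  have h := SimpleGraph.tendsto_resistanceDiam_sub
  have h1 := (tendsto_add_atTop_iff_nat 1).2 h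
  have h2 := SimpleGraph.tendsto_pathGreen_zero_sub (t := 2) two_pos
  have h4 := (SimpleGraph.tendsto_pathGreen_zero_sub (t := 4) four_pos).div_const 2
  -- The added `1 / 4` is the increment of `(n - 1) / 4`.
  have h5 := (((h1.sub h).add h2).add h4).add_const (1 / 4)
  simp only [sub_self, add_zero, zero_div, zero_add] at h5
  refine h5.congr fun n => ?_
  simp only [SimpleGraph.endResistance]
  push_cast
  ring
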